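/- **Max-of-smooth functions.** Let $f\colon\mathbb{R}^d\to\mathbb{R}$ be locally Lipschitz, let $\bar x$ be a local minimizer of $f$, and let $(f_i)_{i\in I}$ be a finite nonempty family of $C^4$ functions $f_i\colon\mathbb{R}^d\to\mathbb{R}$ such that the family of gradients $(\nabla f_i(\bar x))_{i\in I}$ is affinely independent and $$f(x)=\max_{i\in I} f_i(x)\qquad\text{for all } x \text{ near } \bar x.$$ Let $\partial f(x)$ denote the Clarke subdifferential, i.e. the convex hull of all limits $\lim_k\nabla f(x_k)$ along sequences $x_k\to x$ of points of differentiability of $f$. Suppose that * (strict complementarity) $0\in\mathrm{ri}\,\partial f(\bar x)$, and * (quadratic growth) there is $\gamma>0$ with $f(x)-f(\bar x)\ge\frac{\gamma}{2}\|x-\bar x\|^2$ for all $x$ near $\bar x$. Then $f$ satisfies Assumption A at $\bar x$. That is, $f$ is locally Lipschitz, $\bar x$ is a local minimizer of $f$, and: * (A1) (quadratic growth) there is $\gamma>0$ with $f(x)-f(\bar x)\ge\frac{\gamma}{2}\|x-\bar x\|^2$ for all $x$ near $\bar x$; and there is a set $\mathcal{M}\subseteq\mathbb{R}^d$ such that: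 * (A2) (active manifold) $\bar x\in\mathcal{M}$, $0\in\partial f(\bar x)$, $\mathcal{M}$ is a $C^4$-smooth manifold around $\bar x$, the restriction of $f$ to $\mathcal{M}$ is $C^4$-smooth around $\bar x$, and for some neighborhood $U$ of $\bar x$, $\inf\{\|v\| : v\in\partial f(x),\ x\in U\setminus\mathcal{M}\}>0$; * (A3) (strong $(a)$-regularity) there is $C>0$ such that $\|P_{T_{\mathcal{M}}(y)}(v-\nabla_{\mathcal{M}}f(y))\|\le C\|x-y\|$ for all $x\in\mathbb{R}^d$ and $y\in\mathcal{M}$ near $\bar x$ and all $v\in\partial f(x)$; * (A4) ($(b_\le)$-regularity) there is a function $o\colon\mathbb{R}\to\mathbb{R}$ with $o(0)=0$ and $\lim_{t\to0}o(t)/t=0$ such that $f(y)\ge f(x)+\langle v,y-x\rangle+o(\|y-x\|)$ for all $x\in\mathbb{R}^d$ and $y\in\mathcal{M}$ near $\bar x$ and all $v\in\partial f(x)$. Here $\mathcal{M}$ is a $C^p$-smooth manifold around a point $x$ if, for some $m$ and some open neighborhood $U$ of $x$, there is a $C^p$ map $F\colon U\to\mathbb{R}^m$ with surjective derivative at every point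 of $U$ and $\mathcal{M}\cap U=F^{-1}(0)$; for $x\in\mathcal{M}$, its tangent space is $T_{\mathcal{M}}(x)=\ker\nabla F(x)$, and $P_{T_{\mathcal{M}}(x)}$ is the orthogonal projection onto it. The restriction of $f$ to $\mathcal{M}$ is $C^q$-smooth around $x$ if some $C^q$ function $\hat f$ on an open neighborhood $U$ of $x$ agrees with $f$ on $U\cap\mathcal{M}$; the covariant gradient is then $\nabla_{\mathcal{M}}f(x)=P_{T_{\mathcal{M}}(x)}(\nabla\hat f(x))$. Neither notion depends on the choice of $F$ or $\hat f$. -/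

import Mathlib

namespace NonsmoothOpt

/-- The Clarke subdifferential of `f` at `x`: the convex hull of all limits of gradients of `f`
along sequences of points of differentiability converging to `x`. -/
def clarkeSubdifferential {d : ℕ} (f : EuclideanSpace ℝ (Fin d) → ℝ)
    (x : EuclideanSpace ℝ (Fin d)) : Set (EuclideanSpace ℝ (Fin d)) :=
  convexHull ℝ {v | ∃ u : ℕ → EuclideanSpace ℝ (Fin d),
    (∀ n, DifferentiableAt ℝ f (u n)) ∧
    Filter.Tendsto u Filter.atTop (nhds x) ∧
    Filter.Tendsto (fun n => gradient f (u n)) Filter.atTop (nhds v)}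

/-- `F` is a `C^p` local defining map of the set `M` around `x`: on an open neighborhood `U` of `x`,
`F` is `C^p` with surjective derivative, and `M ∩ U` is the zero set of `F` in `U`. -/
def IsLocalDefiningMap {d : ℕ} (p : ℕ) {m : ℕ}
    (F : EuclideanSpace ℝ (Fin d) → EuclideanSpace ℝ (Fin m))
    (M : Set (EuclideanSpace ℝ (Fin d))) (x : EuclideanSpace ℝ (Fin d)) : Prop :=
  ∃ U : Set (EuclideanSpace ℝ (Fin d)), IsOpen U ∧ x ∈ U ∧ ContDiffOn ℝ p F U ∧
    (∀ z ∈ U, Function.Surjective (fderiv ℝ F z)) ∧ M ∩ U = {z ∈ U | F z = 0}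

/-- `M` is a `C^p`-smooth manifold around `x` (for `p ≥ 1`). -/
def IsSmoothManifoldAround {d : ℕ} (p : ℕ) (M : Set (EuclideanSpace ℝ (Fin d)))
    (x : EuclideanSpace ℝ (Fin d)) : Prop :=
  ∃ (m : ℕ) (F : EuclideanSpace ℝ (Fin d) → EuclideanSpace ℝ (Fin m)), IsLocalDefiningMap p F M x

/-- `g` is a `C^q` extension, near `x`, of the restriction of `f` to `M`. -/
def IsSmoothExtension {d : ℕ} (q : ℕ) (f : EuclideanSpace ℝ (Fin d) → ℝ)
    (M : Set (EuclideanSpace ℝ (Fin d))) (x : EuclideanSpace ℝ (Fin d))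
    (g : EuclideanSpace ℝ (Fin d) → ℝ) : Prop :=
  ∃ U : Set (EuclideanSpace ℝ (Fin d)), IsOpen U ∧ x ∈ U ∧ ContDiffOn ℝ q g U ∧
    Set.EqOn g f (U ∩ M)

/-- The restriction of `f` to `M` is `C^q`-smooth around `x` (for `q ≥ 1`). -/
def IsSmoothOnManifoldAround {d : ℕ} (q : ℕ) (f : EuclideanSpace ℝ (Fin d) → ℝ)
    (M : Set (EuclideanSpace ℝ (Fin d))) (x : EuclideanSpace ℝ (Fin d)) : Prop :=
  ∃ g : EuclideanSpace ℝ (Fin d) → ℝ, IsSmoothExtension q f M x g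

open Classical in
/-- The tangent space to `M` at `x ∈ M`: the kernel of the derivative at `x` of a local defining map
of `M` around `x`. By `tangentSpace_eq` it does not depend on the defining map. (The value is the
junk value `⊤` if `M` is not a smooth manifold around `x`.) -/
noncomputable def tangentSpace {d : ℕ} (M : Set (EuclideanSpace ℝ (Fin d)))
    (x : EuclideanSpace ℝ (Fin d)) : Submodule ℝ (EuclideanSpace ℝ (Fin d)) :=
  if h : IsSmoothManifoldAround 1 M x then
    LinearMap.ker (fderiv ℝ h.choose_spec.choose x).toLinearMap
  else ⊤

open Classical in
/-- The covariant gradient at `x ∈ M` of a function `f` that is smooth along `M`: the orthogonal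
projection onto the tangent space of the gradient at `x` of a `C^1` extension of the restriction of
`f` to `M`. By `covariantGradient_eq` it does not depend on the extension. (The value is the junk
value `0` if there is no `C^1` extension around `x`.) -/
noncomputable def covariantGradient {d : ℕ} (f : EuclideanSpace ℝ (Fin d) → ℝ)
    (M : Set (EuclideanSpace ℝ (Fin d))) (x : EuclideanSpace ℝ (Fin d)) :
    EuclideanSpace ℝ (Fin d) :=
  if h : IsSmoothOnManifoldAround 1 f M x then
    (tangentSpace M x).starProjection (gradient h.choose x)
  else 0

/-- A map that is constant on `M` near `x` has vanishing derivative on the kernel of the derivative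
of a local defining map. -/
theorem fderiv_eq_zero_of_const_on {d p m : ℕ} (hp : 1 ≤ p)
    {F : EuclideanSpace ℝ (Fin d) → EuclideanSpace ℝ (Fin m)}
    {M : Set (EuclideanSpace ℝ (Fin d))} {x : EuclideanSpace ℝ (Fin d)}
    (hF : IsLocalDefiningMap p F M x) (hx : x ∈ M)
    {G : Type*} [NormedAddCommGroup G] [NormedSpace ℝ G] {g : EuclideanSpace ℝ (Fin d) → G} {c : G}
    (hg : DifferentiableAt ℝ g x) (hc : ∀ᶠ z in nhdsWithin x M, g z = c)
    {v : EuclideanSpace ℝ (Fin d)} (hv : fderiv ℝ F x v = 0) : fderiv ℝ g x v = 0 := by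
  obtain ⟨U, hU, hxU, hcd, hsurj, hM⟩ := hF
  have hst : HasStrictFDerivAt F (fderiv ℝ F x) x :=
    (hcd.contDiffAt (hU.mem_nhds hxU)).hasStrictFDerivAt (by
      simpa using Nat.one_le_iff_ne_zero.mp hp)
  have hr : (fderiv ℝ F x).range = ⊤ := LinearMap.range_eq_top.mpr (hsurj x hxU)
  have hFx : F x = 0 := by
    have : x ∈ M ∩ U := ⟨hx, hxU⟩
    rw [hM] at this
    exact this.2
  set φ := hst.implicitFunction F (fderiv ℝ F x) hr (F x) with hφ
  have hd : HasStrictFDerivAt φ (fderiv ℝ F x).ker.subtypeL 0 := hst.to_implicitFunction hr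
  have hφ0 : φ 0 = x := hst.implicitFunction_apply_image hr
  have hcont : Filter.Tendsto φ (nhds 0) (nhds x) := by
    have := hd.hasFDerivAt.continuousAt.tendsto
    rwa [hφ0] at this
  have hzero : ∀ᶠ w in nhds (0 : (fderiv ℝ F x).ker), F (φ w) = 0 := by
    have h1 := hst.map_implicitFunction_eq hr
    have h2 : Filter.Tendsto (fun w : (fderiv ℝ F x).ker => (F x, w)) (nhds 0)
        (nhds (F x, 0)) :=
      (continuous_const.prodMk continuous_id).tendsto _
    filter_upwards [h2.eventually h1] with w hw
    rw [← hFx]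
    exact hw
  have hin : ∀ᶠ w in nhds (0 : (fderiv ℝ F x).ker), φ w ∈ M := by
    filter_upwards [hzero, hcont.eventually (hU.mem_nhds hxU)] with w h1 h2
    have : φ w ∈ M ∩ U := by rw [hM]; exact ⟨h2, h1⟩
    exact this.1
  have hcg : ∀ᶠ w in nhds (0 : (fderiv ℝ F x).ker), g (φ w) = c :=
    (tendsto_nhdsWithin_iff.mpr ⟨hcont, hin⟩).eventually hc
  have hcomp : HasFDerivAt (fun w => g (φ w))
      ((fderiv ℝ g x).comp (fderiv ℝ F x).ker.subtypeL) 0 := by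
    refine HasFDerivAt.comp (g := g) (f := φ) 0 ?_ hd.hasFDerivAt
    rw [hφ0]
    exact hg.hasFDerivAt
  have hconst : HasFDerivAt (fun w => g (φ w)) (0 : (fderiv ℝ F x).ker →L[ℝ] G) 0 :=
    (hasFDerivAt_const c 0).congr_of_eventuallyEq hcg
  have := DFunLike.congr_fun (hcomp.unique hconst) ⟨v, hv⟩
  simpa using this

theorem IsLocalDefiningMap.mono {d p q m : ℕ} (hqp : q ≤ p)
    {F : EuclideanSpace ℝ (Fin d) → EuclideanSpace ℝ (Fin m)}
    {M : Set (EuclideanSpace ℝ (Fin d))} {x : EuclideanSpace ℝ (Fin d)}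
    (hF : IsLocalDefiningMap p F M x) : IsLocalDefiningMap q F M x := by
  obtain ⟨U, hU, hxU, hcd, h⟩ := hF
  exact ⟨U, hU, hxU, hcd.of_le (by exact_mod_cast hqp), h⟩

/-- The kernel of the derivative is the same for all local defining maps. -/
theorem ker_fderiv_le {d p q m n : ℕ} (hp : 1 ≤ p) (hq : 1 ≤ q)
    {F : EuclideanSpace ℝ (Fin d) → EuclideanSpace ℝ (Fin m)}
    {G : EuclideanSpace ℝ (Fin d) → EuclideanSpace ℝ (Fin n)}
    {M : Set (EuclideanSpace ℝ (Fin d))} {x : EuclideanSpace ℝ (Fin d)}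
    (hF : IsLocalDefiningMap p F M x) (hG : IsLocalDefiningMap q G M x) (hx : x ∈ M) :
    LinearMap.ker (fderiv ℝ F x).toLinearMap ≤ LinearMap.ker (fderiv ℝ G x).toLinearMap := by
  intro v hv
  obtain ⟨U, hU, hxU, hcd, -, hM⟩ := hG
  refine fderiv_eq_zero_of_const_on (c := 0) hp hF hx ?_ ?_ hv
  · exact (hcd.contDiffAt (hU.mem_nhds hxU)).differentiableAt (by
      simpa using Nat.one_le_iff_ne_zero.mp hq)
  · filter_upwards [self_mem_nhdsWithin, mem_nhdsWithin_of_mem_nhds (hU.mem_nhds hxU)] with z h1 h2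
    have : z ∈ M ∩ U := ⟨h1, h2⟩
    rw [hM] at this
    exact this.2

/-- The tangent space can be computed with any local defining map. -/
theorem tangentSpace_eq {d p m : ℕ} (hp : 1 ≤ p)
    {F : EuclideanSpace ℝ (Fin d) → EuclideanSpace ℝ (Fin m)}
    {M : Set (EuclideanSpace ℝ (Fin d))} {x : EuclideanSpace ℝ (Fin d)}
    (hF : IsLocalDefiningMap p F M x) (hx : x ∈ M) :
    tangentSpace M x = LinearMap.ker (fderiv ℝ F x).toLinearMap := by
  have h : IsSmoothManifoldAround 1 M x := ⟨m, F, hF.mono hp⟩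
  rw [tangentSpace, dif_pos h]
  exact le_antisymm (ker_fderiv_le le_rfl hp h.choose_spec.choose_spec hF hx)
    (ker_fderiv_le hp le_rfl hF h.choose_spec.choose_spec hx)

/-- The covariant gradient can be computed with any smooth extension. -/
theorem covariantGradient_eq {d p q : ℕ} (hp : 1 ≤ p) (hq : 1 ≤ q)
    {f g : EuclideanSpace ℝ (Fin d) → ℝ}
    {M : Set (EuclideanSpace ℝ (Fin d))} {x : EuclideanSpace ℝ (Fin d)}
    (hM : IsSmoothManifoldAround p M x) (hx : x ∈ M) (hg : IsSmoothExtension q f M x g) :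
    covariantGradient f M x = (tangentSpace M x).starProjection (gradient g x) := by
  have hg1 : IsSmoothExtension 1 f M x g := by
    obtain ⟨U, hU, hxU, hcd, h⟩ := hg
    exact ⟨U, hU, hxU, hcd.of_le (by exact_mod_cast hq), h⟩
  have h : IsSmoothOnManifoldAround 1 f M x := ⟨g, hg1⟩
  rw [covariantGradient, dif_pos h]
  have hk := h.choose_spec
  set k := h.choose
  obtain ⟨m, F, hF⟩ := hM
  obtain ⟨U, hU, hxU, hcdU, hEU⟩ := hg1
  obtain ⟨V, hV, hxV, hcdV, hEV⟩ := hk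
  have hgd : DifferentiableAt ℝ g x :=
    (hcdU.contDiffAt (hU.mem_nhds hxU)).differentiableAt (by simp)
  have hkd : DifferentiableAt ℝ k x :=
    (hcdV.contDiffAt (hV.mem_nhds hxV)).differentiableAt (by simp)
  have key : ∀ v ∈ tangentSpace M x, inner ℝ (gradient k x - gradient g x) v = 0 := by
    intro v hv
    rw [tangentSpace_eq hp hF hx] at hv
    have h0 : fderiv ℝ (k - g) x v = 0 := by
      refine fderiv_eq_zero_of_const_on (c := 0) hp hF hx (hkd.sub hgd) ?_ hv
      filter_upwards [self_mem_nhdsWithin, mem_nhdsWithin_of_mem_nhds (hU.mem_nhds hxU),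
        mem_nhdsWithin_of_mem_nhds (hV.mem_nhds hxV)] with z h1 h2 h3
      simp [hEU ⟨h2, h1⟩, hEV ⟨h3, h1⟩]
    rw [fderiv_sub hkd hgd] at h0
    simpa [inner_sub_left, gradient, InnerProductSpace.toDual_symm_apply] using h0
  rw [← sub_eq_zero, ← map_sub, Submodule.starProjection_apply_eq_zero_iff]
  rw [Submodule.mem_orthogonal']
  exact key

/-- `M` is an active `C^p`-manifold for `f` around `x`. -/
def IsActiveManifold {d : ℕ} (p : ℕ) (f : EuclideanSpace ℝ (Fin d) → ℝ)
    (M : Set (EuclideanSpace ℝ (Fin d))) (x : EuclideanSpace ℝ (Fin d)) : Prop :=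
  x ∈ M ∧ 0 ∈ clarkeSubdifferential f x ∧
  IsSmoothManifoldAround p M x ∧ IsSmoothOnManifoldAround p f M x ∧
  ∃ U ∈ nhds x, ∃ ε > (0 : ℝ), ∀ z ∈ U \ M, ∀ v ∈ clarkeSubdifferential f z, ε ≤ ‖v‖

/-- Quadratic growth of `f` at `x`. -/
def QuadraticGrowth {d : ℕ} (f : EuclideanSpace ℝ (Fin d) → ℝ)
    (x : EuclideanSpace ℝ (Fin d)) : Prop :=
  ∃ γ > (0 : ℝ), ∀ᶠ z in nhds x, f z - f x ≥ γ / 2 * ‖z - x‖ ^ 2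

/-- Strict complementarity of `f` at `x`: zero lies in the relative interior of the
Clarke subdifferential. -/
def StrictComplementarity {d : ℕ} (f : EuclideanSpace ℝ (Fin d) → ℝ)
    (x : EuclideanSpace ℝ (Fin d)) : Prop :=
  0 ∈ intrinsicInterior ℝ (clarkeSubdifferential f x)

/-- Strong (a)-regularity of `f` along `M` at `x`. -/
def StrongARegular {d : ℕ} (f : EuclideanSpace ℝ (Fin d) → ℝ)
    (M : Set (EuclideanSpace ℝ (Fin d))) (x : EuclideanSpace ℝ (Fin d)) : Prop :=
  ∃ C > (0 : ℝ), ∃ U ∈ nhds x, ∀ z ∈ U, ∀ v ∈ clarkeSubdifferential f z, ∀ y ∈ U ∩ M,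
    ‖(tangentSpace M y).starProjection (v - covariantGradient f M y)‖ ≤ C * ‖z - y‖

/-- (b≤)-regularity of `f` along `M` at `x`. -/
def BLeRegular {d : ℕ} (f : EuclideanSpace ℝ (Fin d) → ℝ)
    (M : Set (EuclideanSpace ℝ (Fin d))) (x : EuclideanSpace ℝ (Fin d)) : Prop :=
  ∃ o : ℝ → ℝ, o =o[nhds 0] (fun t : ℝ => t) ∧
    ∃ U ∈ nhds x, ∀ z ∈ U, ∀ v ∈ clarkeSubdifferential f z, ∀ y ∈ U ∩ M,
      f y ≥ f z + inner ℝ v (y - z) + o ‖y - z‖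

/-- Assumption A for `f` at `x`; the same manifold `M` serves in all the conditions. -/
def AssumptionA {d : ℕ} (f : EuclideanSpace ℝ (Fin d) → ℝ)
    (x : EuclideanSpace ℝ (Fin d)) : Prop :=
  LocallyLipschitz f ∧ IsLocalMin f x ∧ QuadraticGrowth f x ∧
  ∃ M : Set (EuclideanSpace ℝ (Fin d)),
    IsActiveManifold 4 f M x ∧ StrongARegular f M x ∧ BLeRegular f M x

end NonsmoothOpt

namespace NonsmoothOpt

open Filter Topology

variable {d : ℕ} {I : Type*}

/-! Near `xbar`, `f` is a maximum of smooth pieces, and every Clarke subgradient at `z` is a convex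
combination of gradients of pieces active at `z` (`clarkeSubdifferential_subset`). The manifold is
the ridge `M` on which all pieces active at `xbar` agree. Each condition on subgradients describes a
convex set of `v`, so it need only be checked at the gradients of active pieces.

Affine independence supplies dual vectors `h j`, constant on all gradients at `xbar` except the
`j`-th, where the value is larger by 1. Paired with the differences of active gradients they give an
identity matrix, so the equations of `M` have surjective derivative. Strict complementarity makes
the constant negative (`inner_lt_zero_of_strictComplementarity`). Off `M` some piece `j` active at
`xbar` has dropped out, so `h j` is uniformly negative on all subgradients, and these stay away from
0.

Differences of active gradients are normal to `M`; with Lipschitz gradients this yields strong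
(a)-regularity. A Taylor bound for each active piece, together with `F i ≤ f`, yields
(b≤)-regularity. -/

/-- Vectors that separate each point of an affinely independent family from all the others. -/
theorem exists_dual_of_affineIndependent {E : Type*} [NormedAddCommGroup E] [InnerProductSpace ℝ E]
    [FiniteDimensional ℝ E] {g : I → E} (hg : AffineIndependent ℝ g) (j : I) :
    ∃ h : E, ∀ i, i ≠ j → inner ℝ h (g i) = inner ℝ h (g j) - 1 := by
  have hli := (affineIndependent_iff_linearIndependent_vsub ℝ g j).mp hg
  -- The functional is -1 on each independent difference `g i - g j`, then extended from their span.
  obtain ⟨φ, hφ⟩ := LinearMap.exists_extend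
    ((Module.Basis.span hli).constr ℝ (fun _ => (-1 : ℝ)))
  refine ⟨(InnerProductSpace.toDual ℝ E).symm φ.toContinuousLinearMap, fun i hi => ?_⟩
  have h1 : φ (g i - g j) = -1 := by
    have h2 := (Module.Basis.span hli).constr_basis ℝ (fun _ => (-1 : ℝ)) ⟨i, hi⟩
    rw [← hφ] at h2
    simpa [Module.Basis.span_apply] using h2
  rw [map_sub] at h1
  simp only [InnerProductSpace.toDual_symm_apply, LinearMap.coe_toContinuousLinearMap']
  linarith

theorem inner_gradient_left {F : EuclideanSpace ℝ (Fin d) → ℝ} (x v : EuclideanSpace ℝ (Fin d)) :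
    inner ℝ (gradient F x) v = fderiv ℝ F x v := by
  simp [gradient, InnerProductSpace.toDual_symm_apply]

theorem contDiff_gradient {F : EuclideanSpace ℝ (Fin d) → ℝ} {n m : WithTop ℕ∞}
    (hF : ContDiff ℝ n F) (hmn : m + 1 ≤ n) : ContDiff ℝ m (gradient F) :=
  (InnerProductSpace.toDual ℝ (EuclideanSpace ℝ (Fin d))).symm.contDiff.comp
    (hF.fderiv_right hmn)

/-! ### The Clarke subdifferential of a finite maximum -/

/-- Where a maximum is differentiable, its gradient is the gradient of every active function. -/
theorem gradient_eq_of_eventually_le {f g : EuclideanSpace ℝ (Fin d) → ℝ}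
    {x : EuclideanSpace ℝ (Fin d)} (hf : DifferentiableAt ℝ f x) (hg : DifferentiableAt ℝ g x)
    (hle : ∀ᶠ z in 𝓝 x, g z ≤ f z) (heq : g x = f x) : gradient f x = gradient g x := by
  have hmin : IsLocalMin (f - g) x := by
    filter_upwards [hle] with z hz
    simp only [Pi.sub_apply]
    linarith
  have h0 := hmin.fderiv_eq_zero
  rw [fderiv_sub hf hg, sub_eq_zero] at h0
  simp [gradient, h0]

/-- The Clarke subdifferential of a maximum is contained in any convex set that contains the
gradients of the active functions. -/
theorem clarkeSubdifferential_subset [Fintype I] [Nonempty I]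
    {f : EuclideanSpace ℝ (Fin d) → ℝ} {F : I → EuclideanSpace ℝ (Fin d) → ℝ}
    {z : EuclideanSpace ℝ (Fin d)} (hF : ∀ i, ContDiff ℝ 1 (F i))
    (hmax : ∀ᶠ x in 𝓝 z, f x = Finset.univ.sup' Finset.univ_nonempty (fun i => F i x))
    {K : Set (EuclideanSpace ℝ (Fin d))} (hK : Convex ℝ K)
    (hact : ∀ i, F i z = f z → gradient (F i) z ∈ K) : clarkeSubdifferential f z ⊆ K := by
  refine convexHull_min ?_ hK
  rintro v ⟨u, hu, hlim, hgrad⟩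
  have h1 : ∀ᶠ n in atTop, ∃ i, F i (u n) = f (u n) ∧ gradient f (u n) = gradient (F i) (u n) := by
    filter_upwards [hlim.eventually hmax.eventually_nhds] with n hn
    obtain ⟨i, -, hi⟩ := Finset.exists_mem_eq_sup' Finset.univ_nonempty (fun i => F i (u n))
    have hi' : F i (u n) = f (u n) := by rw [hn.self_of_nhds, hi]
    refine ⟨i, hi', gradient_eq_of_eventually_le (hu n)
      ((hF i).differentiable (by simp)).differentiableAt ?_ hi'⟩
    filter_upwards [hn] with y hy
    rw [hy]
    exact Finset.le_sup' (fun i => F i y) (Finset.mem_univ i)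
  -- Pigeonhole: as `I` is finite, one index is active along a subsequence, and continuity passes
  -- both its value and its gradient to the limit.
  obtain ⟨i, hi⟩ := (frequently_exists).mp h1.frequently
  obtain ⟨φ, hφ, hφi⟩ := extraction_of_frequently_atTop hi
  have hlimφ : Tendsto (u ∘ φ) atTop (𝓝 z) := hlim.comp hφ.tendsto_atTop
  have hfc : ContinuousAt f z := by
    have hc : Continuous fun x => Finset.univ.sup' Finset.univ_nonempty (fun i => F i x) :=
      Continuous.finset_sup'_apply _ fun i _ => (hF i).continuous
    exact hc.continuousAt.congr (hmax.mono fun _ h => h.symm)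
  have hval : F i z = f z := by
    refine tendsto_nhds_unique (((hF i).continuous.tendsto z).comp hlimφ) ?_
    refine (hfc.tendsto.comp hlimφ).congr fun n => ?_
    exact (hφi n).1.symm
  have hv : v = gradient (F i) z := by
    refine tendsto_nhds_unique (hgrad.comp hφ.tendsto_atTop) ?_
    have hc : Continuous (gradient (F i)) :=
      (contDiff_gradient (m := 0) (hF i) (by simp)).continuous
    refine ((hc.tendsto z).comp hlimφ).congr fun n => ?_
    exact (hφi n).2.symm
  exact hv ▸ hact i hval

/-- The gradient of an active function that can be made strictly maximal to first order belongs to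
the Clarke subdifferential of the maximum. -/
theorem gradient_mem_clarkeSubdifferential [Fintype I] [Nonempty I]
    {f : EuclideanSpace ℝ (Fin d) → ℝ} {F : I → EuclideanSpace ℝ (Fin d) → ℝ}
    {x h : EuclideanSpace ℝ (Fin d)} (hF : ∀ i, ContDiff ℝ 1 (F i))
    (hmax : ∀ᶠ z in 𝓝 x, f z = Finset.univ.sup' Finset.univ_nonempty (fun i => F i z))
    {j : I} (hj : F j x = f x)
    (hh : ∀ i, i ≠ j → inner ℝ h (gradient (F i) x) < inner ℝ h (gradient (F j) x)) :
    gradient (F j) x ∈ clarkeSubdifferential f x := by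
  have hline : Tendsto (fun t : ℝ => x + t • h) (𝓝[>] 0) (𝓝 x) := by
    have hc : Continuous fun t : ℝ => x + t • h := by fun_prop
    simpa using (hc.tendsto 0).mono_left nhdsWithin_le_nhds
  have hlt : ∀ i, i ≠ j → ∀ᶠ t : ℝ in 𝓝[>] 0, F i (x + t • h) < F j (x + t • h) := by
    intro i hij
    have hle : F i x ≤ F j x := by
      rw [hj, hmax.self_of_nhds]
      exact Finset.le_sup' (fun i => F i x) (Finset.mem_univ i)
    -- A strict gap at `x` persists by continuity; a tie is broken by the slopes along `h`.
    rcases hle.lt_or_eq with hlt | heq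
    · exact hline.eventually
        ((hF i).continuous.continuousAt.eventually_lt (hF j).continuous.continuousAt hlt)
    · have hd : ∀ k, HasDerivAt (fun t : ℝ => F k (x + t • h)) (inner ℝ h (gradient (F k) x)) 0 := by
        intro k
        rw [real_inner_comm, inner_gradient_left]
        have h1 : HasDerivAt (fun t : ℝ => x + t • h) h 0 := by
          simpa using ((hasDerivAt_id (0 : ℝ)).smul_const h).const_add x
        have h2 : HasFDerivAt (F k) (fderiv ℝ (F k) x) (x + (0 : ℝ) • h) := by
          simpa using (((hF k).differentiable (by simp)) x).hasFDerivAt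
        exact h2.comp_hasDerivAt 0 h1
      have hd' := (hd j).sub (hd i)
      have hpos := hd'.hasDerivWithinAt (s := Set.Ioi 0)
      rw [hasDerivWithinAt_iff_tendsto_slope' (by simp)] at hpos
      have := hpos.eventually (lt_mem_nhds (sub_pos.mpr (hh i hij)))
      filter_upwards [this, self_mem_nhdsWithin] with t ht ht0
      have ht0' : (0 : ℝ) < t := ht0
      rw [slope_def_field] at ht
      simp only [Pi.sub_apply, zero_smul, add_zero, heq, sub_self, sub_zero] at ht
      have := (div_pos_iff_of_pos_right ht0').mp ht
      linarith
  -- Strict dominance is an open condition, so `f` coincides with `F j` around `x + t • h` and is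
  -- differentiable there.
  have hev : ∀ᶠ t : ℝ in 𝓝[>] 0, ∀ᶠ z in 𝓝 (x + t • h), f z = F j z := by
    have hlt' : ∀ᶠ t : ℝ in 𝓝[>] 0, ∀ i, i ≠ j → F i (x + t • h) < F j (x + t • h) := by
      rw [eventually_all]
      intro i
      by_cases hij : i = j
      · simp [hij]
      · filter_upwards [hlt i hij] with t ht _ using ht
    filter_upwards [hlt', hline.eventually hmax.eventually_nhds] with t ht hmt
    have hz : ∀ᶠ z in 𝓝 (x + t • h), ∀ i, F i z ≤ F j z := by
      rw [eventually_all]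
      intro i
      by_cases hij : i = j
      · simp [hij]
      · filter_upwards [(hF i).continuous.continuousAt.eventually_lt
          (hF j).continuous.continuousAt (ht i hij)] with z hz using hz.le
    filter_upwards [hz, hmt] with z hz hmz
    rw [hmz]
    exact le_antisymm (Finset.sup'_le _ _ fun i _ => hz i)
      (Finset.le_sup' (fun i => F i z) (Finset.mem_univ j))
  obtain ⟨t, ht, htev⟩ := exists_seq_forall_of_frequently hev.frequently
  refine subset_convexHull ℝ _ ⟨fun n => x + t n • h, fun n => ?_, hline.comp ht, ?_⟩
  · exact (((hF j).differentiable (by simp)) _).congr_of_eventuallyEq (htev n)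
  · have hc : Continuous (gradient (F j)) :=
      (contDiff_gradient (m := 0) (hF j) (by simp)).continuous
    refine ((hc.tendsto x).comp (hline.comp ht)).congr fun n => ?_
    have : f =ᶠ[𝓝 (x + t n • h)] F j := htev n
    simp [gradient, this.fderiv_eq]

/-- From a point of the relative interior one can move a little away from any point of the set. -/
theorem exists_neg_smul_mem_of_zero_mem_intrinsicInterior {E : Type*} [NormedAddCommGroup E]
    [NormedSpace ℝ E] {C : Set E} (h0 : (0 : E) ∈ intrinsicInterior ℝ C) {g : E} (hg : g ∈ C) :
    ∃ δ > (0 : ℝ), -(δ • g) ∈ C := by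
  obtain ⟨p, hp, hp0⟩ := h0
  -- The relative interior is an interior within the affine span, so the path must be seen to stay
  -- in that span.
  have hspan : ∀ t : ℝ, -(t • g) ∈ affineSpan ℝ C := by
    intro t
    have h0' : (0 : E) ∈ affineSpan ℝ C := hp0 ▸ p.2
    have := AffineMap.lineMap_mem (-t) h0' (subset_affineSpan ℝ C hg)
    simpa [AffineMap.lineMap_apply] using this
  have hcont : Continuous fun t : ℝ => (⟨-(t • g), hspan t⟩ : affineSpan ℝ C) := by
    fun_prop
  have hp' : (⟨-((0 : ℝ) • g), hspan 0⟩ : affineSpan ℝ C) = p := by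
    ext
    simp [hp0]
  have hev := (hcont.tendsto 0).eventually
    (by rw [hp']; exact mem_interior_iff_mem_nhds.mp hp)
  obtain ⟨t, ht, ht0⟩ := ((hev.filter_mono nhdsWithin_le_nhds).and
    (self_mem_nhdsWithin : Set.Ioi (0 : ℝ) ∈ 𝓝[>] 0)).exists
  exact ⟨t, ht0, ht⟩

/-! ### Local estimates for smooth families -/

/-- A first order Taylor estimate for a function with Lipschitz gradient. -/
theorem taylor_lower_bound {F : EuclideanSpace ℝ (Fin d) → ℝ} (hF : Differentiable ℝ F) {L : ℝ}
    {s : Set (EuclideanSpace ℝ (Fin d))} (hs : Convex ℝ s)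
    (hL : ∀ x ∈ s, ∀ y ∈ s, ‖gradient F x - gradient F y‖ ≤ L * ‖x - y‖) (hL0 : 0 ≤ L)
    {x y : EuclideanSpace ℝ (Fin d)} (hx : x ∈ s) (hy : y ∈ s) :
    F x + inner ℝ (gradient F x) (y - x) - L * ‖y - x‖ ^ 2 ≤ F y := by
  -- Mean value inequality for `F` minus its linearization at `x`; on the segment the derivative of
  -- the difference is at most `L * ‖y - x‖`.
  have h := (convex_segment x y).norm_image_sub_le_of_norm_hasFDerivWithin_le'
    (f := F) (f' := fderiv ℝ F) (φ := fderiv ℝ F x) (C := L * ‖y - x‖) (x := x) (y := y)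
    (fun z _ => (hF z).hasFDerivAt.hasFDerivWithinAt) ?_
    (left_mem_segment ℝ x y) (right_mem_segment ℝ x y)
  · rw [Real.norm_eq_abs, abs_le] at h
    rw [inner_gradient_left]
    nlinarith [h.1]
  · intro z hz
    have h1 : ‖fderiv ℝ F z - fderiv ℝ F x‖ = ‖gradient F z - gradient F x‖ := by
      rw [gradient, gradient, ← map_sub, LinearIsometryEquiv.norm_map]
    rw [h1]
    refine (hL z (hs.segment_subset hx hy hz) x hx).trans ?_
    gcongr
    obtain ⟨a, b, ha, hb, hab, rfl⟩ := hz
    have : a • x + b • y - x = b • (y - x) := by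
      rw [show a = 1 - b by linarith]; module
    rw [this, norm_smul, Real.norm_of_nonneg hb]
    exact mul_le_of_le_one_left (norm_nonneg _) (by linarith)

/-- If `h` is dual to the differences `∇ F (e k) - ∇ F i₀` at `x`, then near `x` the map with
components `F (e k) - F i₀` has surjective derivative. -/
theorem eventually_surjective_fderiv {F : I → EuclideanSpace ℝ (Fin d) → ℝ}
    (hF : ∀ i, ContDiff ℝ 1 (F i)) {m : ℕ} (e : Fin m → I) (i₀ : I)
    (h : Fin m → EuclideanSpace ℝ (Fin d)) {x : EuclideanSpace ℝ (Fin d)}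
    (hh : ∀ k l, inner ℝ (gradient (F (e k)) x - gradient (F i₀) x) (h l) =
      if k = l then 1 else 0) :
    ∀ᶠ z in 𝓝 x, Function.Surjective
      (fderiv ℝ (fun z => WithLp.toLp 2 fun k => F (e k) z - F i₀ z :
        EuclideanSpace ℝ (Fin d) → EuclideanSpace ℝ (Fin m)) z) := by
  have hc : ∀ i, Continuous (gradient (F i)) := fun i =>
    (contDiff_gradient (m := 0) (hF i) (by simp)).continuous
  let A : EuclideanSpace ℝ (Fin d) → Matrix (Fin m) (Fin m) ℝ := fun z =>
    Matrix.of fun k l => inner ℝ (gradient (F (e k)) z - gradient (F i₀) z) (h l)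
  have hAc : Continuous A := by
    refine continuous_matrix fun k l => ?_
    exact ((hc _).sub (hc _)).inner continuous_const
  have hA1 : A x = 1 := by
    ext k l
    simp [A, hh, Matrix.one_apply]
  have hdet : ∀ᶠ z in 𝓝 x, (A z).det ≠ 0 :=
    hAc.matrix_det.continuousAt.eventually_ne (by simp [hA1])
  filter_upwards [hdet] with z hz w
  have hd : ∀ i, HasFDerivAt (F i) (fderiv ℝ (F i) z) z := fun i =>
    (((hF i).differentiable (by simp)) z).hasFDerivAt
  have hder : ∀ v k, fderiv ℝ (fun z => WithLp.toLp 2 fun k => F (e k) z - F i₀ z :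
        EuclideanSpace ℝ (Fin d) → EuclideanSpace ℝ (Fin m)) z v k =
      inner ℝ (gradient (F (e k)) z - gradient (F i₀) z) v := by
    intro v k
    have h1 : HasFDerivAt (fun z => fun k => F (e k) z - F i₀ z)
        (ContinuousLinearMap.pi fun k => fderiv ℝ (F (e k)) z - fderiv ℝ (F i₀) z) z :=
      hasFDerivAt_pi.mpr fun k => (hd _).sub (hd _)
    have h2 := ((PiLp.continuousLinearEquiv 2 ℝ (fun _ : Fin m => ℝ)).symm
      |>.toContinuousLinearMap.hasFDerivAt.comp z h1).fderiv
    have h3 := congrArg (fun T => T v k) h2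
    simp only [inner_sub_left, inner_gradient_left]
    exact h3
  -- On the span of the `h l` the derivative acts as the matrix `A z`, which is invertible near `x`
  -- because `A x = 1`.
  refine ⟨∑ l, ((A z)⁻¹.mulVec w.ofLp) l • h l, ?_⟩
  ext k
  rw [hder, inner_sum]
  have hmul : (A z).mulVec ((A z)⁻¹.mulVec w.ofLp) = w.ofLp := by
    rw [Matrix.mulVec_mulVec, Matrix.mul_nonsing_inv _ (isUnit_iff_ne_zero.mpr hz),
      Matrix.one_mulVec]
  have := congrFun hmul k
  rw [← this, Matrix.mulVec, dotProduct]
  refine Finset.sum_congr rfl fun l _ => ?_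
  rw [inner_smul_right, mul_comm]
  rfl

/-- Gradients of finitely many `C²` functions are uniformly Lipschitz near every point. -/
theorem exists_lipschitz_gradient [Fintype I] {F : I → EuclideanSpace ℝ (Fin d) → ℝ}
    (hF : ∀ i, ContDiff ℝ 2 (F i)) (x : EuclideanSpace ℝ (Fin d)) :
    ∃ L > (0 : ℝ), ∃ s ∈ 𝓝 x, ∀ y ∈ s, ∀ z ∈ s, ∀ i,
      ‖gradient (F i) y - gradient (F i) z‖ ≤ L * ‖y - z‖ := by
  have hc : ContDiff ℝ 1 fun z => fun i => gradient (F i) z :=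
    contDiff_pi.mpr fun i => contDiff_gradient (hF i) (by norm_num)
  obtain ⟨K, s, hs, hK⟩ := hc.contDiffAt.exists_lipschitzOnWith (x := x)
  refine ⟨K + 1, by positivity, s, hs, fun y hy z hz i => ?_⟩
  have h1 := (dist_le_pi_dist _ _ i).trans (hK.dist_le_mul y hy z hz)
  rw [dist_eq_norm, dist_eq_norm] at h1
  refine h1.trans ?_
  gcongr
  linarith

/-! ### Strict complementarity and the dual vectors -/

/-- Under strict complementarity the dual vector of an active gradient is negative on the other
active gradients. -/
theorem inner_lt_zero_of_strictComplementarity [Fintype I] [Nonempty I]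
    {f : EuclideanSpace ℝ (Fin d) → ℝ} {F : I → EuclideanSpace ℝ (Fin d) → ℝ}
    {x h : EuclideanSpace ℝ (Fin d)} (hF : ∀ i, ContDiff ℝ 1 (F i))
    (hmax : ∀ᶠ z in 𝓝 x, f z = Finset.univ.sup' Finset.univ_nonempty (fun i => F i z))
    (hsc : StrictComplementarity f x) {j : I} (hj : F j x = f x)
    (hh : ∀ i, i ≠ j → inner ℝ h (gradient (F i) x) = inner ℝ h (gradient (F j) x) - 1) :
    inner ℝ h (gradient (F j) x) - 1 < 0 := by
  have hmem := gradient_mem_clarkeSubdifferential hF hmax hj (h := h)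
    (fun i hi => by rw [hh i hi]; linarith)
  obtain ⟨δ, hδ, hδm⟩ := exists_neg_smul_mem_of_zero_mem_intrinsicInterior hsc hmem
  have hsub : clarkeSubdifferential f x ⊆
      {v | inner ℝ h (gradient (F j) x) - 1 ≤ inner ℝ h v} := by
    refine clarkeSubdifferential_subset hF hmax
      (convex_halfSpace_ge (innerSL ℝ h).toLinearMap.isLinear _) fun i _ => ?_
    by_cases hij : i = j
    · subst hij; simp
    · exact (hh i hij).ge
  have h1 := hsub hδm
  -- With `a` the lower bound, `h` equals `a + 1` on the `j`-th gradient, so `a ≤ -δ * (a + 1)`,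
  -- which is impossible for `a ≥ 0`.
  simp only [Set.mem_ofPred_eq, inner_neg_right, inner_smul_right] at h1
  nlinarith

end NonsmoothOpt

/-! ### Verification of the assumption along the ridge -/

open Filter Topology NonsmoothOpt in
theorem mainTheorem6 {d : ℕ} {I : Type*} [Fintype I] [Nonempty I]
    (f : EuclideanSpace ℝ (Fin d) → ℝ) (F : I → EuclideanSpace ℝ (Fin d) → ℝ)
    (xbar : EuclideanSpace ℝ (Fin d))
    (hf : LocallyLipschitz f)
    (hF : ∀ i, ContDiff ℝ 4 (F i))
    (hmin : IsLocalMin f xbar)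
    (haff : AffineIndependent ℝ (fun i => gradient (F i) xbar))
    (hmax : ∀ᶠ x in nhds xbar, f x = Finset.univ.sup' Finset.univ_nonempty (fun i => F i x))
    (hsc : NonsmoothOpt.StrictComplementarity f xbar)
    (hqg : NonsmoothOpt.QuadraticGrowth f xbar) :
    NonsmoothOpt.AssumptionA f xbar := by
  have hF1 : ∀ i, ContDiff ℝ 1 (F i) := fun i => (hF i).of_le (by norm_num)
  have hF2 : ∀ i, ContDiff ℝ 2 (F i) := fun i => (hF i).of_le (by norm_num)
  have hgc : ∀ i, Continuous (gradient (F i)) := fun i =>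
    (contDiff_gradient (m := 0) (hF1 i) (by simp)).continuous
  choose h hh using exists_dual_of_affineIndependent haff
  obtain ⟨i₀, -, hi₀⟩ := Finset.exists_mem_eq_sup' Finset.univ_nonempty (fun i => F i xbar)
  replace hi₀ : F i₀ xbar = f xbar := by rw [hmax.self_of_nhds, hi₀]
  -- The common value of `h j` on the gradients other than the `j`-th.
  set a : I → ℝ := fun j => inner ℝ (h j) (gradient (F j) xbar) - 1 with ha
  have ha0 : ∀ j, F j xbar = f xbar → a j < 0 := fun j hj =>
    inner_lt_zero_of_strictComplementarity hF1 hmax hsc hj (hh j)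
  let M : Set (EuclideanSpace ℝ (Fin d)) := {z | ∀ i, F i xbar = f xbar → F i z = F i₀ z}
  obtain ⟨m, ⟨e⟩⟩ := Finite.exists_equiv_fin {i // F i xbar = f xbar ∧ i ≠ i₀}
  let G : EuclideanSpace ℝ (Fin d) → EuclideanSpace ℝ (Fin m) := fun z =>
    WithLp.toLp 2 fun k => F (e.symm k) z - F i₀ z
  have hsurj : ∀ᶠ z in 𝓝 xbar, Function.Surjective (fderiv ℝ G z) := by
    refine eventually_surjective_fderiv hF1 (fun k => (e.symm k : I)) i₀
      (fun l => h (e.symm l)) fun k l => ?_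
    rw [real_inner_comm, inner_sub_right, hh _ _ (e.symm l).2.2.symm]
    split_ifs with hkl
    · subst hkl; ring
    · rw [hh _ _ fun hne => hkl (e.symm.injective (Subtype.ext hne))]; ring
  obtain ⟨L, hL, s, hs, hLip⟩ := exists_lipschitz_gradient hF2 xbar
  have hinact : ∀ᶠ z in 𝓝 xbar, ∀ i, F i z = f z → F i xbar = f xbar := by
    rw [eventually_all]
    intro i
    by_cases hi : F i xbar = f xbar
    · simp [hi]
    · have hlt : F i xbar < F i₀ xbar := by
        refine lt_of_le_of_ne ?_ (by rwa [hi₀])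
        rw [hi₀, hmax.self_of_nhds]
        exact Finset.le_sup' (fun i => F i xbar) (Finset.mem_univ i)
      filter_upwards [(hF i).continuous.continuousAt.eventually_lt
        (hF i₀).continuous.continuousAt hlt, hmax] with z hz hmz hiz
      have := Finset.le_sup' (fun i => F i z) (Finset.mem_univ i₀)
      rw [← hmz] at this
      linarith
  have hneg : ∀ᶠ z in 𝓝 xbar, ∀ j i, i ≠ j → F j xbar = f xbar →
      inner ℝ (h j) (gradient (F i) z) < a j / 2 := by
    simp only [eventually_all]
    intro j i hij hj
    have hc : Continuous fun z => inner ℝ (h j) (gradient (F i) z) :=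
      continuous_const.inner (hgc i)
    -- The value at `xbar` is `a j`, which lies strictly below `a j / 2` since `a j < 0`.
    refine hc.continuousAt.eventually_lt continuousAt_const ?_
    rw [hh j i hij]
    have := ha0 j hj
    simp only [ha] at this ⊢
    linarith
  obtain ⟨ε, hε, hball⟩ := Metric.eventually_nhds_iff_ball.mp
    (hmax.and (hsurj.and (hinact.and (hneg.and hs))))
  set U := Metric.ball xbar ε
  have hUo : IsOpen U := Metric.isOpen_ball
  have hxU : xbar ∈ U := Metric.mem_ball_self hε
  have hle : ∀ z ∈ U, ∀ i, F i z ≤ f z := fun z hz i => by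
    rw [(hball z hz).1]
    exact Finset.le_sup' (fun i => F i z) (Finset.mem_univ i)
  have hsub : ∀ z ∈ U, ∀ K : Set (EuclideanSpace ℝ (Fin d)), Convex ℝ K →
      (∀ i, F i z = f z → gradient (F i) z ∈ K) → clarkeSubdifferential f z ⊆ K :=
    fun z hz K hK hact => clarkeSubdifferential_subset hF1
      (by filter_upwards [hUo.mem_nhds hz] with y hy using (hball y hy).1) hK hact
  have hfM : ∀ z ∈ U, z ∈ M → ∀ i, F i xbar = f xbar → F i z = f z := by
    intro z hz hzM i hi
    -- A piece attaining the maximum at `z` is active at `xbar`, hence on `M` it ties with all the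
    -- others active there.
    obtain ⟨k, -, hk⟩ := Finset.exists_mem_eq_sup' Finset.univ_nonempty (fun i => F i z)
    have hk' : F k z = f z := by rw [(hball z hz).1, hk]
    rw [hzM i hi, ← hzM k ((hball z hz).2.2.1 k hk'), hk']
  have hdef : ∀ z ∈ U, IsLocalDefiningMap 4 G M z := by
    refine fun z hz => ⟨U, hUo, hz, ?_, fun y hy => (hball y hy).2.1, ?_⟩
    · refine ContDiff.contDiffOn ?_
      exact contDiff_euclidean.mpr fun k => (hF _).sub (hF _)
    · ext y
      constructor
      · rintro ⟨hyM, hyU⟩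
        refine ⟨hyU, ?_⟩
        ext k
        simp [G, hyM _ (e.symm k).2.1]
      · rintro ⟨hyU, hGy⟩
        refine ⟨fun i hi => ?_, hyU⟩
        by_cases hii : i = i₀
        · rw [hii]
        · have := congrArg (fun w => w (e ⟨i, hi, hii⟩)) hGy
          simpa [G, sub_eq_zero] using this
  have hext : ∀ z ∈ U, IsSmoothExtension 4 f M z (F i₀) := fun z hz =>
    ⟨U, hUo, hz, (hF i₀).contDiffOn, fun y hy => hfM y hy.1 hy.2 i₀ hi₀⟩
  have htan : ∀ y ∈ U ∩ M, ∀ i, F i xbar = f xbar →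
      (tangentSpace M y).starProjection (gradient (F i) y) =
        (tangentSpace M y).starProjection (gradient (F i₀) y) := by
    rintro y ⟨hyU, hyM⟩ i hi
    rw [← sub_eq_zero, ← map_sub, Submodule.starProjection_apply_eq_zero_iff,
      Submodule.mem_orthogonal']
    intro v hv
    rw [tangentSpace_eq (by norm_num) (hdef y hyU) hyM] at hv
    have hd : ∀ k, DifferentiableAt ℝ (F k) y := fun k => ((hF1 k).differentiable (by simp)) y
    have h0 := fderiv_eq_zero_of_const_on (c := 0) (g := F i - F i₀) (by norm_num) (hdef y hyU)
      hyM ((hd i).sub (hd i₀))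
      (by filter_upwards [self_mem_nhdsWithin] with z hz
          simp [hz i hi]) hv
    rw [fderiv_sub (hd i) (hd i₀)] at h0
    simpa [inner_sub_left, inner_gradient_left] using h0
  refine ⟨hf, hmin, hqg, M, ⟨fun i hi => by rw [hi, hi₀], intrinsicInterior_subset hsc,
    ⟨m, G, hdef xbar hxU⟩, ⟨F i₀, hext xbar hxU⟩, U, hUo.mem_nhds hxU, ?_⟩,
    ⟨L, hL, U, hUo.mem_nhds hxU, ?_⟩, ⟨fun t => -(L * t ^ 2), ?_, U, hUo.mem_nhds hxU, ?_⟩⟩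
  · have hpt : ∀ j, ∃ ε > (0 : ℝ), F j xbar = f xbar → ∀ v : EuclideanSpace ℝ (Fin d),
        inner ℝ (h j) v ≤ a j / 2 → ε ≤ ‖v‖ := by
      intro j
      by_cases hj : F j xbar = f xbar
      · have haj := ha0 j hj
        -- Cauchy–Schwarz bound; the `+ 1` keeps the denominator positive.
        refine ⟨-a j / 2 / (‖h j‖ + 1), by apply div_pos <;> [linarith; positivity],
          fun _ v hv => ?_⟩
        rw [div_le_iff₀ (by positivity)]
        have h1 := (abs_le.mp (abs_real_inner_le_norm (h j) v)).1
        nlinarith [norm_nonneg v]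
      -- A dummy value, so that the minimum can run over all of `I`.
      · exact ⟨1, one_pos, fun hj' => absurd hj' hj⟩
    choose η hη hηv using hpt
    refine ⟨Finset.univ.inf' Finset.univ_nonempty η,
      (Finset.lt_inf'_iff _).mpr fun j _ => hη j, ?_⟩
    rintro z ⟨hzU, hzM⟩ v hv
    obtain ⟨j, hj, hjz⟩ : ∃ j, F j xbar = f xbar ∧ F j z ≠ f z := by
      by_contra! hcon
      exact hzM fun i hi => by rw [hcon i hi, hcon i₀ hi₀]
    refine (Finset.inf'_le η (Finset.mem_univ j)).trans (hηv j hj v ?_)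
    refine hsub z hzU {v | inner ℝ (h j) v ≤ a j / 2}
      (convex_halfSpace_le (innerSL ℝ (h j)).toLinearMap.isLinear _) (fun i hi => ?_) hv
    -- Since `j` is inactive at `z`, every active `i` differs from `j`.
    exact ((hball z hzU).2.2.2.1 j i (fun hij => hjz (hij ▸ hi)) hj).le
  · rintro z hzU v hv y hy
    rw [covariantGradient_eq (p := 4) (by norm_num) (q := 4) (by norm_num) ⟨m, G, hdef y hy.1⟩ hy.2
      (hext y hy.1)]
    set P := (tangentSpace M y).starProjection
    have hPP : ∀ w, P (P w) = P w := fun w =>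
      Submodule.starProjection_eq_self_iff.mpr (Submodule.starProjection_apply_mem _ w)
    rw [map_sub, hPP]
    refine hsub z hzU {v | ‖P v - P (gradient (F i₀) y)‖ ≤ L * ‖z - y‖} ?_ (fun i hi => ?_) hv
    · have hconv := (convex_closedBall (P (gradient (F i₀) y)) (L * ‖z - y‖)).linear_preimage
        P.toLinearMap
      simpa [Set.preimage, Metric.mem_closedBall, dist_eq_norm] using hconv
    -- At `y` the projected gradient of `F i₀` can be traded for that of `F i`, leaving two
    -- gradients of the same function to compare.
    · rw [Set.mem_ofPred_eq, ← htan y hy i ((hball z hzU).2.2.1 i hi), ← map_sub]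
      exact (Submodule.norm_starProjection_apply_le _ _).trans
        (hLip z (hball z hzU).2.2.2.2 y (hball y hy.1).2.2.2.2 i)
  · refine (Asymptotics.IsLittleO.const_mul_left ?_ L).neg_left
    simpa using Asymptotics.isLittleO_pow_pow (𝕜 := ℝ) (m := 1) (n := 2) one_lt_two
  · rintro z hzU v hv y hy
    have hv' := hsub z hzU {v | inner ℝ (y - z) v ≤ f y - f z + L * ‖y - z‖ ^ 2}
      (convex_halfSpace_le (innerSL ℝ (y - z)).toLinearMap.isLinear _) (fun i hi => ?_) hv
    · rw [Set.mem_ofPred_eq, real_inner_comm] at hv'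
      linarith
    -- Taylor at `z` for the active piece, where `F i z = f z`, then `F i y ≤ f y`.
    · rw [Set.mem_ofPred_eq, real_inner_comm]
      have := taylor_lower_bound ((hF1 i).differentiable (by simp)) (convex_ball xbar ε)
        (fun x hx y hy => hLip x (hball x hx).2.2.2.2 y (hball y hy).2.2.2.2 i) hL.le hzU hy.1
      have := hle y hy.1 i
      linarith
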